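/- Let $n\ge 1$, let $\mathbb{U}$ be the open unit disc of $\mathbb{C}$, equip $\mathbb{C}^n$ with the norm $\|z\|=\max_{1\le k\le n}|z_k|$, and let $\mathbb{U}^n=\{z\in\mathbb{C}^n:\|z\|<1\}$ be the unit polydisc. Let $\Phi:\mathbb{U}\to\mathbb{C}$ be biholomorphic onto its image, with $\Phi(0)=1$, $\operatorname{Re}\Phi>0$ on $\mathbb{U}$, $\Phi'(0)>0$, $\Phi''(0)\in\mathbb{R}$, and suppose that $$|\Phi''(0)+2(\Phi'(0))^2|\ge 2\Phi'(0).$$ Let $\mathcal{M}_\Phi$ be the class of holomorphic mappings $p=(p_1,\dots,p_n):\mathbb{U}^n\to\mathbb{C}^n$ with $p(0)=0$, $Dp(0)=I$ and $z_k/p_k(z)\in\Phi(\mathbb{U})$ for every $z\in\mathbb{U}^n\setminus\{0\}$ and every $k$ with $|z_k|=\|z\|$. Let $g:\mathbb{U}^n\to\mathbb{C}$ be holomorphic with $g(0)=1$, put $G(z)=z\,g(z)$, and suppose that $DG(z)$ is invertible for every $z\in\mathbb{U}^n$ and that the mapping $z\mapsto (DG(z))^{-1}G(z)$ belongs to $\mathcal{M}_\Phi$.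 Then, with squares of vectors taken componentwise, $$\left\|\left(\frac{D^3G(0)(z^3)}{3!}\right)^2-\left(\frac{D^2G(0)(z^2)}{2!}\right)^2\right\|\le \frac{(\Phi'(0))^2\|z\|^6}{4}\left(\frac12\frac{\Phi''(0)}{\Phi'(0)}+\Phi'(0)\right)^2+(\Phi'(0))^2\|z\|^4,\qquad z\in\mathbb{U}^n,$$ where $D^mG(0)(z^m)$ is the $m$-th Fréchet derivative of $G$ at $0$ applied to $(z,\dots,z)$. The bound is sharp: for every such $n$ and $\Phi$ there is a function $g$ satisfying all these hypotheses such that for every $r\in(0,1)$ equality holds at some $z\in\mathbb{U}^n$ with $\|z\|=r$. -/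

import Mathlib

noncomputable section

/-- The open unit disc of the complex plane. -/
def unitDisc : Set ℂ := Metric.ball 0 1

/-- The open unit polydisc of `ℂⁿ`: the unit ball for the norm `‖z‖ = max_k |z_k|`, which is the
norm that `Fin n → ℂ` carries. -/
def unitPolydisc (n : ℕ) : Set (Fin n → ℂ) := Metric.ball 0 1

/-- `f` is holomorphic on the set `s` (meant for open `s`) of a complex normed space: around every
point of `s` it is given by a convergent power series
`f w = ∑ k, (1 / k!) D^k f(z) (w - z, …, w - z)`. -/
def HolomorphicOn {E F : Type*} [NormedAddCommGroup E] [NormedSpace ℂ E]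
    [NormedAddCommGroup F] [NormedSpace ℂ F] (f : E → F) (s : Set E) : Prop :=
  AnalyticOnNhd ℂ f s

/-- `f` is biholomorphic on `s ⊆ ℂ`: it is holomorphic, its image is a domain, and it has an
inverse that is holomorphic on the image. -/
def BiholomorphicOn (f : ℂ → ℂ) (s : Set ℂ) : Prop :=
  DifferentiableOn ℂ f s ∧ IsOpen (f '' s) ∧ IsConnected (f '' s) ∧
    ∃ h : ℂ → ℂ, DifferentiableOn ℂ h (f '' s) ∧ ∀ z ∈ s, h (f z) = z

/-- The functions `Φ` that are allowed as parameters: `Φ` is biholomorphic on the unit disc,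
`Φ 0 = 1`, `Re Φ > 0`, `Φ' 0 > 0` and `Φ'' 0` is real. -/
structure IsAdmissible (Φ : ℂ → ℂ) : Prop where
  biholomorphic : BiholomorphicOn Φ unitDisc
  map_zero : Φ 0 = 1
  re_pos : ∀ z ∈ unitDisc, 0 < (Φ z).re
  deriv_im : (deriv Φ 0).im = 0
  deriv_pos : 0 < (deriv Φ 0).re
  deriv2_im : (iteratedDeriv 2 Φ 0).im = 0

/-- The class `M_Φ` on the unit polydisc: the holomorphic mappings `p` with `p 0 = 0`,
`Dp(0) = I` and `z_k / p_k(z) ∈ Φ(U)` for all `z ≠ 0` in the polydisc and all `k` such that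
`|z_k| = ‖z‖`. -/
def classM (n : ℕ) (Φ : ℂ → ℂ) : Set ((Fin n → ℂ) → (Fin n → ℂ)) :=
  {p | HolomorphicOn p (unitPolydisc n) ∧ p 0 = 0 ∧
    fderiv ℂ p 0 = ContinuousLinearMap.id ℂ (Fin n → ℂ) ∧
    ∀ z ∈ unitPolydisc n, z ≠ 0 → ∀ k : Fin n, ‖z k‖ = ‖z‖ →
      p z k ≠ 0 ∧ z k / p z k ∈ Φ '' unitDisc}

/-- The mapping `G(z) = z g(z)` that belongs to a scalar function `g`. -/
def scaledId {n : ℕ} (g : (Fin n → ℂ) → ℂ) : (Fin n → ℂ) → (Fin n → ℂ) :=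
  fun z => g z • z

/-- `DG(z)` is invertible at every point of the polydisc and `z ↦ (DG(z))⁻¹ G(z)` is a member of
`M_Φ`. -/
def InvDerivMemClassM {n : ℕ} (Φ : ℂ → ℂ) (G : (Fin n → ℂ) → (Fin n → ℂ)) : Prop :=
  (∀ z ∈ unitPolydisc n, (fderiv ℂ G z).IsInvertible) ∧
    (fun z => (fderiv ℂ G z).inverse (G z)) ∈ classM n Φ

/-- The hypotheses on `g`: it is a holomorphic function on the polydisc, `g 0 = 1`, and
`G(z) = z g(z)` satisfies `(DG)⁻¹ G ∈ M_Φ`. -/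
def IsGenerator {n : ℕ} (Φ : ℂ → ℂ) (g : (Fin n → ℂ) → ℂ) : Prop :=
  HolomorphicOn g (unitPolydisc n) ∧ g 0 = 1 ∧ InvDerivMemClassM Φ (scaledId g)

/-- The homogeneous term `D^m G(0)(z^m) / m!` of the expansion of `G` at the origin. -/
def homTerm {n : ℕ} (m : ℕ) (G : (Fin n → ℂ) → (Fin n → ℂ)) (z : Fin n → ℂ) : Fin n → ℂ :=
  ((m.factorial : ℂ)⁻¹) • iteratedFDeriv ℂ m G 0 (fun _ => z)

/-- The bound, as a function of `a = Φ' 0`, `b = Φ'' 0` and `r = ‖z‖`. -/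
def toeplitzBound (a b r : ℝ) : ℝ :=
  a ^ 2 * r ^ 6 / 4 * (1 / 2 * (b / a) + a) ^ 2 + (a * r ^ 2) ^ 2

end

/-!
Fix `u` with `‖u‖ = 1` and restrict `g` to the disc through `u`: `f t = g (t u)`. Since
`DG(z) z = (g z + Dg(z) z) z`, the mapping `(DG)⁻¹ G` is `g / (g + Dg(z) z)` times the identity, so
membership in `M_Φ` says that `1 + t f'(t) / f(t)` takes its values in `Φ(U)`
(`mem_image_of_invDerivMemClassM`). Composing with the inverse of `Φ` gives a self-map
`ω(t) = t ψ(t)` of the disc, with `|ψ| ≤ 1` by the Schwarz lemma, and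
`f'(t) = f(t) ψ(t) D(t ψ(t))` where `Φ(w) = 1 + w D(w)`, i.e. `D = dslope Φ 0`
(`IsGenerator.exists_schwarz_function`).

With `a = Φ'(0)` and `b = Φ''(0)`, so that `D(0) = a` and `D'(0) = b / 2`, differentiating this
equation once more at `0` gives
`f'(0) = a ψ(0)` and `f''(0) = (a² + b / 2) ψ(0)² + a ψ'(0)`.
The Schwarz-Pick inequality `|ψ'(0)| + |ψ(0)|² ≤ 1` (`norm_deriv_add_sq_le_one`) and the assumption,
which reads `a ≤ |a² + b / 2|`, give `|f'(0)| ≤ a` and `|f''(0)| ≤ |a² + b / 2|`. Because the terms of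
degree two and three of `G(t u) = t f(t) u` are `f'(0) u` and `f''(0) / 2 u`, the bound is the triangle
inequality.

Equality occurs for `ψ = i`: then `f'(0)² = -a²` while `f''(0)²` is positive, so that the two terms add
up. The corresponding `g` is `z ↦ E(z_k)`, where `E(w) = exp (L (i w))` and `L` is the primitive of `D`
with `L(0) = 0`.
-/

/-! ### Homogeneous terms along complex lines -/

theorem iteratedDeriv_two_id_mul {h : ℂ → ℂ} (hh : AnalyticAt ℂ h 0) :
    iteratedDeriv 2 (fun t => t * h t) 0 = 2 * deriv h 0 := by
  have := iteratedDeriv_fun_mul (𝕜 := ℂ) (n := 2) (x := 0) (f := fun t : ℂ => t) (g := h)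
    contDiffAt_id (hh.contDiffAt)
  rw [this]
  simp [Finset.sum_range_succ, iteratedDeriv_succ]

theorem iteratedDeriv_three_id_mul {h : ℂ → ℂ} (hh : AnalyticAt ℂ h 0) :
    iteratedDeriv 3 (fun t => t * h t) 0 = 3 * deriv (deriv h) 0 := by
  have := iteratedDeriv_fun_mul (𝕜 := ℂ) (n := 3) (x := 0) (f := fun t : ℂ => t) (g := h)
    contDiffAt_id (hh.contDiffAt)
  rw [this]
  simp [Finset.sum_range_succ, iteratedDeriv_succ]

/-- The power series of `G` at `0`, composed with `t ↦ t • z`, is the power series of the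
restriction of `G` to the line through `z`. -/
theorem iteratedFDeriv_apply_const_eq_iteratedDeriv {E F : Type*} [NormedAddCommGroup E]
    [NormedSpace ℂ E] [NormedAddCommGroup F] [NormedSpace ℂ F] [CompleteSpace F] {G : E → F}
    (hG : AnalyticAt ℂ G 0) (z : E) (m : ℕ) :
    iteratedFDeriv ℂ m G 0 (fun _ => z) = iteratedDeriv m (fun t : ℂ => G (t • z)) 0 := by
  obtain ⟨p, r, hp⟩ := hG
  have hp' : HasFPowerSeriesAt G p ((ContinuousLinearMap.toSpanSingleton ℂ z) 0) := by
    simpa using hp.hasFPowerSeriesAt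
  obtain ⟨r', hq⟩ := hp'.compContinuousLinearMap
  have h1 := hp.factorial_smul z m
  have h2 := hq.factorial_smul 1 m
  rw [← h1, iteratedDeriv_eq_iteratedFDeriv]
  refine Eq.trans ?_ h2
  rw [FormalMultilinearSeries.compContinuousLinearMap_apply]
  simp [Function.comp_def]

theorem homTerm_smul {n : ℕ} (m : ℕ) (G : (Fin n → ℂ) → (Fin n → ℂ)) (c : ℂ) (z : Fin n → ℂ) :
    homTerm m G (c • z) = c ^ m • homTerm m G z := by
  unfold homTerm
  have := (iteratedFDeriv ℂ m G 0).map_smul_univ (fun _ => c) (fun _ => z)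
  rw [this, smul_comm]
  simp

theorem analyticAt_comp_line {E F : Type*} [NormedAddCommGroup E] [NormedSpace ℂ E]
    [NormedAddCommGroup F] [NormedSpace ℂ F] {g : E → F} (hg : AnalyticAt ℂ g 0) (z : E) :
    AnalyticAt ℂ (fun t : ℂ => g (t • z)) 0 := by
  have hg' : AnalyticAt ℂ g ((fun t : ℂ => t • z) 0) := by simpa using hg
  exact hg'.comp (f := fun t : ℂ => t • z) (by fun_prop)

theorem homTerm_scaledId_eq_iteratedDeriv {n : ℕ} {g : (Fin n → ℂ) → ℂ} (hg : AnalyticAt ℂ g 0)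
    (z : Fin n → ℂ) (m : ℕ) :
    homTerm m (scaledId g) z =
      ((m.factorial : ℂ)⁻¹ * iteratedDeriv m (fun t : ℂ => t * g (t • z)) 0) • z := by
  have hG : AnalyticAt ℂ (scaledId g) 0 := hg.smul analyticAt_id
  have hf := analyticAt_comp_line hg z
  unfold homTerm
  rw [iteratedFDeriv_apply_const_eq_iteratedDeriv hG, mul_smul]
  congr 1
  rw [← iteratedDeriv_smul_const]
  · congr 1; funext t; simp [scaledId, smul_smul, mul_comm]
  · exact (analyticAt_id.mul hf).contDiffAt

theorem homTerm_two_scaledId {n : ℕ} {g : (Fin n → ℂ) → ℂ} (hg : AnalyticAt ℂ g 0)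
    (z : Fin n → ℂ) :
    homTerm 2 (scaledId g) z = deriv (fun t : ℂ => g (t • z)) 0 • z := by
  have hf := analyticAt_comp_line hg z
  rw [homTerm_scaledId_eq_iteratedDeriv hg, iteratedDeriv_two_id_mul hf]
  congr 1
  norm_num [Nat.factorial]
  ring

theorem homTerm_three_scaledId {n : ℕ} {g : (Fin n → ℂ) → ℂ} (hg : AnalyticAt ℂ g 0)
    (z : Fin n → ℂ) :
    homTerm 3 (scaledId g) z = (deriv (deriv (fun t : ℂ => g (t • z))) 0 / 2) • z := by
  have hf := analyticAt_comp_line hg z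
  rw [homTerm_scaledId_eq_iteratedDeriv hg, iteratedDeriv_three_id_mul hf]
  congr 1
  norm_num [Nat.factorial]
  ring

/-! ### Second-order identities and inequalities on the disc -/

theorem deriv_dslope_zero {Φ : ℂ → ℂ} (hΦ : DifferentiableOn ℂ Φ unitDisc) :
    deriv (dslope Φ 0) 0 = iteratedDeriv 2 Φ 0 / 2 := by
  have hD : DifferentiableOn ℂ (dslope Φ 0) unitDisc :=
    (Complex.differentiableOn_dslope (Metric.ball_mem_nhds 0 one_pos)).2 hΦ
  have hD' : AnalyticAt ℂ (dslope Φ 0) 0 := hD.analyticAt (Metric.ball_mem_nhds 0 one_pos)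
  have h := iteratedDeriv_two_id_mul hD'
  have h1 : Φ = fun t => Φ 0 + t * dslope Φ 0 t := by
    funext t
    have := sub_smul_dslope Φ 0 t
    simp only [sub_zero, smul_eq_mul] at this
    rw [this]; ring
  conv_rhs => rw [h1]
  rw [iteratedDeriv_const_add (by norm_num), h]
  ring

/-- The first two Taylor coefficients of a solution of `f' = f ψ D(t ψ)`. Writing the equation with
`D` in place of `Φ` keeps it free of the factor `t`, so that one differentiation is enough. -/
theorem deriv_of_logDeriv_eq {f ψ D : ℂ → ℂ} (hf : DifferentiableAt ℂ f 0)
    (hψ : DifferentiableAt ℂ ψ 0) (hD : DifferentiableAt ℂ D 0) (hf0 : f 0 = 1)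
    (h : deriv f =ᶠ[nhds 0] fun t => f t * (ψ t * D (t * ψ t))) :
    deriv f 0 = D 0 * ψ 0 ∧
      deriv (deriv f) 0 = (D 0 ^ 2 + deriv D 0) * ψ 0 ^ 2 + D 0 * deriv ψ 0 := by
  have h0 : deriv f 0 = D 0 * ψ 0 := by rw [h.eq_of_nhds]; simp [hf0, mul_comm]
  refine ⟨h0, ?_⟩
  rw [h.deriv_eq]
  have hin : HasDerivAt (fun t => t * ψ t) (ψ 0) 0 := by
    simpa using (hasDerivAt_id' (0 : ℂ)).fun_mul hψ.hasDerivAt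
  have hD0 : HasDerivAt D (deriv D 0) ((fun t => t * ψ t) 0) := by simpa using hD.hasDerivAt
  have := (hf.hasDerivAt.mul (hψ.hasDerivAt.mul (hD0.comp 0 hin))).deriv
  refine Eq.trans this ?_
  simp only [Function.comp, zero_mul, Pi.mul_apply, h0, hf0]
  ring

/-- The Schwarz-Pick inequality at the origin, for functions with values in the closed disc. The
Schwarz lemma is applied to `s ψ` followed by the disc automorphism that moves `s ψ(0)` to `0`; the
factor `s < 1`, which then tends to `1`, covers the case `|ψ(0)| = 1`. -/
theorem norm_deriv_add_sq_le_one {ψ : ℂ → ℂ} (hψ : DifferentiableOn ℂ ψ unitDisc)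
    (hb : ∀ t ∈ unitDisc, ‖ψ t‖ ≤ 1) : ‖deriv ψ 0‖ + ‖ψ 0‖ ^ 2 ≤ 1 := by
  have h0 : (0 : ℂ) ∈ unitDisc := Metric.mem_ball_self one_pos
  have hd : DifferentiableAt ℂ ψ 0 := hψ.differentiableAt (Metric.ball_mem_nhds 0 one_pos)
  have key : ∀ s ∈ Set.Ioo (0 : ℝ) 1, s * ‖deriv ψ 0‖ + (s * ‖ψ 0‖) ^ 2 ≤ 1 := by
    intro s hs
    set c : ℂ := s * ψ 0 with hc
    have hlt : ∀ t ∈ unitDisc, ‖s * ψ t‖ < 1 := by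
      intro t ht
      rw [norm_mul, Complex.norm_real, Real.norm_of_nonneg hs.1.le]
      nlinarith [hb t ht, hs.1, hs.2, norm_nonneg (ψ t)]
    have hc1 : ‖c‖ < 1 := hlt 0 h0
    have hne : ∀ w : ℂ, ‖w‖ < 1 → 1 - starRingEnd ℂ c * w ≠ 0 := by
      intro w hw h
      have h1 : starRingEnd ℂ c * w = 1 := (sub_eq_zero.1 h).symm
      have h2 := congrArg norm h1
      rw [norm_mul, RCLike.norm_conj, norm_one] at h2
      nlinarith [norm_nonneg c, norm_nonneg w]
    set F : ℂ → ℂ := fun t => (s * ψ t - c) / (1 - starRingEnd ℂ c * (s * ψ t)) with hF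
    have hF0 : F 0 = 0 := by simp [hF, hc]
    have hFd : DifferentiableOn ℂ F (Metric.ball 0 1) :=
      ((hψ.const_mul _).sub_const _).div (((hψ.const_mul _).const_mul _).const_sub _)
        fun t ht => hne _ (hlt t ht)
    have hFb : Set.MapsTo F (Metric.ball 0 1) (Metric.closedBall (F 0) 1) := by
      intro t ht
      have hw := hlt t ht
      rw [hF0, mem_closedBall_zero_iff]
      simp only [hF]
      generalize (s : ℂ) * ψ t = w at hw ⊢
      rw [norm_div, div_le_one (norm_pos_iff.2 (hne w hw)),
        ← sq_le_sq₀ (norm_nonneg _) (norm_nonneg _)]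
      -- `|1 - c̄ w|² - |w - c|²` factors, which shows that the automorphism maps the disc to itself.
      have : ‖1 - starRingEnd ℂ c * w‖ ^ 2 - ‖w - c‖ ^ 2 = (1 - ‖c‖ ^ 2) * (1 - ‖w‖ ^ 2) := by
        simp only [← Complex.normSq_eq_norm_sq, Complex.normSq_apply, Complex.sub_re,
          Complex.sub_im, Complex.mul_re, Complex.mul_im, Complex.conj_re, Complex.conj_im,
          Complex.one_re, Complex.one_im]
        ring
      nlinarith [mul_nonneg (show 0 ≤ 1 - ‖c‖ ^ 2 by nlinarith [norm_nonneg c])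
        (show 0 ≤ 1 - ‖w‖ ^ 2 by nlinarith [norm_nonneg w])]
    have h1 := Complex.norm_deriv_le_one_of_mapsTo_ball hFd hFb one_pos
    have hsq : starRingEnd ℂ c * c = ((‖c‖ ^ 2 : ℝ) : ℂ) := by
      rw [mul_comm, Complex.mul_conj, Complex.normSq_eq_norm_sq]
    have h2 : deriv F 0 = s * deriv ψ 0 / ((1 - ‖c‖ ^ 2 : ℝ) : ℂ) := by
      have hn : HasDerivAt (fun t => s * ψ t) (s * deriv ψ 0) 0 := hd.hasDerivAt.const_mul _
      have := ((hn.sub_const c).div ((hn.const_mul (starRingEnd ℂ c)).const_sub 1)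
        (hne _ hc1)).deriv
      refine Eq.trans this ?_
      have h3 : (1 - starRingEnd ℂ c * (s * ψ 0)) = ((1 - ‖c‖ ^ 2 : ℝ) : ℂ) := by
        rw [← hc, hsq]; push_cast; ring
      have h4 : ((1 - ‖c‖ ^ 2 : ℝ) : ℂ) ≠ 0 := h3 ▸ hne _ hc1
      rw [h3, ← hc]
      field_simp
      ring
    have hpos : 0 < 1 - ‖c‖ ^ 2 := by nlinarith [norm_nonneg c]
    rw [h2, norm_div, norm_mul, Complex.norm_real, Complex.norm_real, Real.norm_of_nonneg hs.1.le,
      Real.norm_of_nonneg hpos.le, div_le_one hpos] at h1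
    have : ‖c‖ = s * ‖ψ 0‖ := by
      rw [hc, norm_mul, Complex.norm_real, Real.norm_of_nonneg hs.1.le]
    rw [← this]; linarith
  have hcont : Continuous fun s : ℝ => s * ‖deriv ψ 0‖ + (s * ‖ψ 0‖) ^ 2 := by fun_prop
  have hlim := (hcont.tendsto 1).mono_left (nhdsWithin_le_nhds (s := Set.Iio 1))
  have := le_of_tendsto hlim (Filter.mem_of_superset (Ioo_mem_nhdsLT one_pos) key)
  simpa using this

/-! ### The derivative of `z ↦ g(z) z` and its inverse -/

theorem fderiv_scaledId {n : ℕ} {g : (Fin n → ℂ) → ℂ} {z : Fin n → ℂ}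
    (hg : DifferentiableAt ℂ g z) (v : Fin n → ℂ) :
    fderiv ℂ (scaledId g) z v = g z • v + fderiv ℂ g z v • z := by
  have h : HasFDerivAt (scaledId g) _ z := hg.hasFDerivAt.smul (hasFDerivAt_id z)
  rw [h.fderiv]
  simp

/-- `(DG)⁻¹ G = g / (g + Dg(z) z) • z`, without division: this holds because `DG(z)` maps `z` to
`(g z + Dg(z) z) • z`. -/
theorem smul_inverse_fderiv_scaledId {n : ℕ} {g : (Fin n → ℂ) → ℂ} {z : Fin n → ℂ}
    (hg : DifferentiableAt ℂ g z) (hinv : (fderiv ℂ (scaledId g) z).IsInvertible) :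
    (g z + fderiv ℂ g z z) • (fderiv ℂ (scaledId g) z).inverse (scaledId g z) = g z • z := by
  have h : fderiv ℂ (scaledId g) z z = (g z + fderiv ℂ g z z) • z := by
    rw [fderiv_scaledId hg, add_smul]
  obtain ⟨e, he⟩ := hinv
  rw [← he] at h ⊢
  rw [ContinuousLinearMap.inverse_equiv]
  apply e.injective
  have h' : e z = (g z + fderiv ℂ g z z) • z := h
  simp [scaledId, h', smul_smul, mul_comm]

/-- `DG(z)` is a rank-one perturbation of `g z • id`; applying `Dg(z)` to `DG(z) v = 0` shows that it
is injective. -/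
theorem isInvertible_fderiv_scaledId {n : ℕ} {g : (Fin n → ℂ) → ℂ} {z : Fin n → ℂ}
    (hg : DifferentiableAt ℂ g z) (h0 : g z ≠ 0) (h1 : g z + fderiv ℂ g z z ≠ 0) :
    (fderiv ℂ (scaledId g) z).IsInvertible := by
  have hinj : Function.Injective (fderiv ℂ (scaledId g) z : (Fin n → ℂ) →ₗ[ℂ] (Fin n → ℂ)) := by
    rw [injective_iff_map_eq_zero]
    intro v hv
    have hv' : g z • v + fderiv ℂ g z v • z = 0 := by
      rw [← fderiv_scaledId hg]; exact hv
    have h2 : fderiv ℂ g z v = 0 := by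
      have := congrArg (fderiv ℂ g z) hv'
      simp only [map_add, map_smul, smul_eq_mul, map_zero] at this
      have h3 : fderiv ℂ g z v * (g z + fderiv ℂ g z z) = 0 := by linear_combination this
      exact (mul_eq_zero.1 h3).resolve_right h1
    simpa [h2, h0] using hv'
  exact ⟨(LinearEquiv.ofInjectiveEndo _ hinj).toContinuousLinearEquiv, by ext; rfl⟩

/-- The defining condition of `M_Φ` on the mapping `(DG)⁻¹ G` is a condition on the radial
logarithmic derivative of `g`, the same for all coordinates of maximal modulus. -/
theorem mem_image_of_invDerivMemClassM {n : ℕ} {Φ : ℂ → ℂ} {g : (Fin n → ℂ) → ℂ}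
    (hg : DifferentiableOn ℂ g (unitPolydisc n)) (hG : InvDerivMemClassM Φ (scaledId g))
    {z : Fin n → ℂ} (hz : z ∈ unitPolydisc n) (hz0 : z ≠ 0) :
    g z ≠ 0 ∧ 1 + fderiv ℂ g z z / g z ∈ Φ '' unitDisc := by
  obtain ⟨i, hi⟩ := Function.ne_iff.1 hz0
  have : Nonempty (Fin n) := ⟨i⟩
  obtain ⟨k, hk⟩ := exists_eq_ciSup_of_finite (f := fun k => ‖z k‖)
  have hk : ‖z k‖ = ‖z‖ := by
    refine le_antisymm (norm_le_pi_norm z k) ((pi_norm_le_iff_of_nonneg (norm_nonneg _)).2 ?_)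
    intro j
    rw [hk]
    exact le_ciSup (f := fun k => ‖z k‖) (Set.finite_range _).bddAbove j
  have hzk : z k ≠ 0 := by
    rw [← norm_ne_zero_iff, hk, norm_ne_zero_iff]; exact hz0
  obtain ⟨hp, hq⟩ := hG.2.2.2.2 z hz hz0 k hk
  have hd := hg.differentiableAt (Metric.isOpen_ball.mem_nhds hz)
  have h := congrFun (smul_inverse_fderiv_scaledId hd (hG.1 z hz)) k
  have hgz : g z ≠ 0 := by
    intro h0
    apply hp
    simp [scaledId, h0]
  refine ⟨hgz, ?_⟩
  simp only [Pi.smul_apply, smul_eq_mul] at h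
  convert hq using 1
  field_simp
  linear_combination h

/-! ### The upper bound -/

/-- On the disc spanned by a unit vector, a generator solves the equation `f' = f ψ D(t ψ)` for some
`ψ` with values in the closed disc. Here `ω(t) = t ψ(t)` is the function with
`1 + t f' / f = Φ ∘ ω`. -/
theorem IsGenerator.exists_schwarz_function {n : ℕ} {Φ : ℂ → ℂ} (hΦ : IsAdmissible Φ)
    {g : (Fin n → ℂ) → ℂ} (hg : IsGenerator Φ g) {z : Fin n → ℂ} (hz : ‖z‖ = 1) :
    ∃ ψ : ℂ → ℂ, DifferentiableOn ℂ ψ unitDisc ∧ (∀ t ∈ unitDisc, ‖ψ t‖ ≤ 1) ∧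
      deriv (fun t : ℂ => g (t • z)) =ᶠ[nhds 0]
        fun t => g (t • z) * (ψ t * dslope Φ 0 (t * ψ t)) := by
  obtain ⟨hgh, hg0, hG⟩ := hg
  obtain ⟨hΦd, -, -, h, hh, hinv⟩ := hΦ.biholomorphic
  have hnhds : unitDisc ∈ nhds (0 : ℂ) := Metric.ball_mem_nhds 0 one_pos
  have h0 : (0 : ℂ) ∈ unitDisc := Metric.mem_ball_self one_pos
  have hgd : DifferentiableOn ℂ g (unitPolydisc n) := hgh.differentiableOn
  have hmaps : ∀ t ∈ unitDisc, t • z ∈ unitPolydisc n := by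
    intro t ht
    simpa [unitPolydisc, unitDisc, norm_smul, hz] using ht
  set f : ℂ → ℂ := fun t => g (t • z) with hf
  have hfd : DifferentiableOn ℂ f unitDisc :=
    hgd.comp (by fun_prop) hmaps
  have hf' : DifferentiableOn ℂ (deriv f) unitDisc := hfd.deriv Metric.isOpen_ball
  have hder : ∀ t ∈ unitDisc, t * deriv f t = fderiv ℂ g (t • z) (t • z) := by
    intro t ht
    have h1 := (hgd.differentiableAt (Metric.isOpen_ball.mem_nhds (hmaps t ht))).hasFDerivAt
    have h2 : HasDerivAt (fun t : ℂ => t • z) z t := by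
      simpa using (hasDerivAt_id' t).smul_const z
    have h3 : HasDerivAt f _ t := h1.comp_hasDerivAt t h2
    rw [h3.deriv, map_smul, smul_eq_mul]
  have hz0 : z ≠ 0 := by rintro rfl; simp at hz
  have hq : ∀ t ∈ unitDisc, f t ≠ 0 ∧ 1 + t * deriv f t / f t ∈ Φ '' unitDisc := by
    intro t ht
    rcases eq_or_ne t 0 with rfl | ht0
    · exact ⟨by simp [hf, hg0], 0, h0, by simp [hΦ.map_zero]⟩
    · rw [hder t ht]
      exact mem_image_of_invDerivMemClassM hgd hG (hmaps t ht) (smul_ne_zero ht0 hz0)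
  set ω : ℂ → ℂ := fun t => h (1 + t * deriv f t / f t) with hω
  have hωd : DifferentiableOn ℂ ω unitDisc :=
    hh.comp (((differentiableOn_id.mul hf').div hfd fun t ht => (hq t ht).1).const_add 1)
      fun t ht => (hq t ht).2
  have hω0 : ω 0 = 0 := by
    simpa [hω, hΦ.map_zero] using hinv 0 h0
  have hωΦ : ∀ t ∈ unitDisc, ω t ∈ unitDisc ∧ Φ (ω t) = 1 + t * deriv f t / f t := by
    intro t ht
    obtain ⟨w, hw, hwq⟩ := (hq t ht).2
    have : ω t = w := by simp only [hω]; rw [← hwq, hinv w hw]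
    rw [this]
    exact ⟨hw, hwq⟩
  have hψd : DifferentiableOn ℂ (dslope ω 0) unitDisc :=
    (Complex.differentiableOn_dslope hnhds).2 hωd
  have hDd : DifferentiableOn ℂ (dslope Φ 0) unitDisc :=
    (Complex.differentiableOn_dslope hnhds).2 hΦd
  have htψ : ∀ t, t * dslope ω 0 t = ω t := by
    intro t
    simpa [hω0] using sub_smul_dslope ω 0 t
  refine ⟨dslope ω 0, hψd, ?_, ?_⟩
  · intro t ht
    have := Complex.norm_dslope_le_div_of_mapsTo_ball (R₂ := 1) hωd (fun s hs => ?_) ht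
    · simpa using this
    · rw [hω0]
      exact Metric.ball_subset_closedBall (hωΦ s hs).1
  · have hDω : DifferentiableOn ℂ (fun t => dslope Φ 0 (t * dslope ω 0 t)) unitDisc := by
      simp only [htψ]
      exact hDd.comp hωd fun t ht => (hωΦ t ht).1
    -- The factor `t` cancels away from `0`; at `0` the identity holds by continuity.
    refine (ContinuousAt.eventuallyEq_nhds_iff_eventuallyEq_nhdsNE
      (hf'.continuousOn.continuousAt hnhds)
      ((hfd.mul (hψd.mul hDω)).continuousOn.continuousAt hnhds)).1 ?_
    filter_upwards [self_mem_nhdsWithin, mem_nhdsWithin_of_mem_nhds hnhds] with t ht0 ht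
    have h1 : Φ (ω t) = 1 + ω t * dslope Φ 0 (ω t) := by
      have := sub_smul_dslope Φ 0 (ω t)
      simp only [sub_zero, smul_eq_mul, hΦ.map_zero] at this
      rw [this]; ring
    have h2 := (hωΦ t ht).2
    have h3 := (hq t ht).1
    rw [h1, add_right_inj, eq_div_iff h3] at h2
    simp only [Pi.mul_apply]
    apply mul_left_cancel₀ (show t ≠ 0 from ht0)
    rw [← h2]
    simp only [htψ]
    rw [← htψ t]
    ring

/-- `deriv_of_logDeriv_eq` for `D = dslope Φ 0`, in terms of the real numbers `Φ'(0)` and `Φ''(0)`. -/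
theorem coeff_of_schwarz_function {n : ℕ} {Φ : ℂ → ℂ} (hΦ : IsAdmissible Φ)
    {g : (Fin n → ℂ) → ℂ} (hg : AnalyticAt ℂ g 0) (hg0 : g 0 = 1) (z : Fin n → ℂ) {ψ : ℂ → ℂ}
    (hψ : DifferentiableOn ℂ ψ unitDisc)
    (h : deriv (fun t : ℂ => g (t • z)) =ᶠ[nhds 0]
        fun t => g (t • z) * (ψ t * dslope Φ 0 (t * ψ t))) :
    deriv (fun t : ℂ => g (t • z)) 0 = (deriv Φ 0).re * ψ 0 ∧
      deriv (deriv (fun t : ℂ => g (t • z))) 0 =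
        (((deriv Φ 0).re ^ 2 + (iteratedDeriv 2 Φ 0).re / 2 : ℝ) : ℂ) * ψ 0 ^ 2 +
          (deriv Φ 0).re * deriv ψ 0 := by
  have hnhds : unitDisc ∈ nhds (0 : ℂ) := Metric.ball_mem_nhds 0 one_pos
  have hΦd := hΦ.biholomorphic.1
  have hD := ((Complex.differentiableOn_dslope hnhds).2 hΦd).differentiableAt hnhds
  have ha : deriv Φ 0 = ((deriv Φ 0).re : ℂ) := Complex.ext rfl (by simp [hΦ.deriv_im])
  have hb : iteratedDeriv 2 Φ 0 = ((iteratedDeriv 2 Φ 0).re : ℂ) :=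
    Complex.ext rfl (by simp [hΦ.deriv2_im])
  have := deriv_of_logDeriv_eq (analyticAt_comp_line hg z).differentiableAt
    (hψ.differentiableAt hnhds) hD (by simp [hg0]) h
  rw [dslope_same, deriv_dslope_zero hΦd] at this
  push_cast
  rw [← ha, ← hb]
  exact this

theorem homTerm_sq_sub_sq {n : ℕ} {g : (Fin n → ℂ) → ℂ} (hg : AnalyticAt ℂ g 0)
    (z : Fin n → ℂ) (r : ℂ) :
    homTerm 3 (scaledId g) (r • z) ^ 2 - homTerm 2 (scaledId g) (r • z) ^ 2 =
      ((r ^ 3 * (deriv (deriv fun t : ℂ => g (t • z)) 0 / 2)) ^ 2 -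
        (r ^ 2 * deriv (fun t : ℂ => g (t • z)) 0) ^ 2) • z ^ 2 := by
  rw [homTerm_smul, homTerm_smul, homTerm_two_scaledId hg, homTerm_three_scaledId hg]
  simp only [smul_smul, smul_pow, sub_smul]

theorem toeplitzBound_eq {a : ℝ} (ha : a ≠ 0) (b r : ℝ) :
    toeplitzBound a b r = (r ^ 3 * ((a ^ 2 + b / 2) / 2)) ^ 2 + (r ^ 2 * a) ^ 2 := by
  unfold toeplitzBound
  field_simp
  ring

theorem IsGenerator.norm_sq_sub_sq_le {n : ℕ} {Φ : ℂ → ℂ} (hΦ : IsAdmissible Φ)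
    (hcond : 2 * (deriv Φ 0).re ≤
      |(iteratedDeriv 2 Φ 0).re + 2 * (deriv Φ 0).re ^ 2|)
    {g : (Fin n → ℂ) → ℂ} (hg : IsGenerator Φ g) (z : Fin n → ℂ) :
    ‖homTerm 3 (scaledId g) z ^ 2 - homTerm 2 (scaledId g) z ^ 2‖ ≤
      toeplitzBound (deriv Φ 0).re (iteratedDeriv 2 Φ 0).re ‖z‖ := by
  have hga : AnalyticAt ℂ g 0 := hg.1 0 (Metric.mem_ball_self one_pos)
  rw [toeplitzBound_eq hΦ.deriv_pos.ne']
  rcases eq_or_ne z 0 with rfl | hz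
  · have := homTerm_sq_sub_sq hga 0 0
    simp only [smul_zero] at this
    rw [this]
    simp
  obtain ⟨u, hu, hzu⟩ : ∃ u : Fin n → ℂ, ‖u‖ = 1 ∧ z = (‖z‖ : ℂ) • u := by
    have hr : (‖z‖ : ℂ) ≠ 0 := by simpa using hz
    refine ⟨(‖z‖ : ℂ)⁻¹ • z, ?_, by rw [smul_smul, mul_inv_cancel₀ hr, one_smul]⟩
    rw [norm_smul, norm_inv, Complex.norm_real, norm_norm, inv_mul_cancel₀ (norm_ne_zero_iff.2 hz)]
  obtain ⟨ψ, hψ, hψ1, hode⟩ := hg.exists_schwarz_function hΦ hu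
  obtain ⟨h1, h2⟩ := coeff_of_schwarz_function hΦ hga hg.2.1 u hψ hode
  have hS := norm_deriv_add_sq_le_one hψ hψ1
  have hψ0 := hψ1 0 (Metric.mem_ball_self one_pos)
  have hsq := homTerm_sq_sub_sq hga u ‖z‖
  rw [← hzu, h1, h2] at hsq
  rw [hsq, norm_smul]
  have ha := hΦ.deriv_pos
  generalize (deriv Φ 0).re = a at *
  generalize (iteratedDeriv 2 Φ 0).re = b at *
  have hB : a ≤ |a ^ 2 + b / 2| := by
    have : b + 2 * a ^ 2 = 2 * (a ^ 2 + b / 2) := by ring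
    rw [this, abs_mul, abs_two] at hcond
    linarith
  have hc2 : ‖((a ^ 2 + b / 2 : ℝ) : ℂ) * ψ 0 ^ 2 + a * deriv ψ 0‖ ≤ |a ^ 2 + b / 2| := by
    refine (norm_add_le _ _).trans ?_
    rw [norm_mul, norm_mul, norm_pow, Complex.norm_real, Complex.norm_real, Real.norm_eq_abs,
      Real.norm_of_nonneg ha.le]
    nlinarith [mul_le_mul_of_nonneg_right hB (norm_nonneg (deriv ψ 0)),
      mul_le_mul_of_nonneg_left hS (abs_nonneg (a ^ 2 + b / 2))]
  have hc1 : ‖(a : ℂ) * ψ 0‖ ≤ a := by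
    rw [norm_mul, Complex.norm_real, Real.norm_of_nonneg ha.le]
    nlinarith
  have hu2 : ‖u ^ 2‖ ≤ 1 := by
    simpa [hu] using norm_pow_le' u two_pos
  refine (mul_le_of_le_one_right (norm_nonneg _) hu2).trans ((norm_sub_le _ _).trans ?_)
  simp only [norm_pow, norm_mul, norm_div, Complex.norm_real, norm_norm,
    Complex.norm_ofNat] at hc1 hc2 ⊢
  have h3 : (‖z‖ ^ 3 * ((a ^ 2 + b / 2) / 2)) ^ 2 = (‖z‖ ^ 3 * (|a ^ 2 + b / 2| / 2)) ^ 2 := by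
    rw [mul_pow, mul_pow, div_pow, div_pow, sq_abs]
  rw [h3]
  gcongr

/-! ### The extremal function -/

theorem analyticOnNhd_comp_apply {n : ℕ} {F : ℂ → ℂ} (hF : DifferentiableOn ℂ F unitDisc)
    (k : Fin n) : AnalyticOnNhd ℂ (fun z : Fin n → ℂ => F (z k)) (unitPolydisc n) := by
  intro z hz
  have hzk : z k ∈ unitDisc := by
    have hz' : ‖z‖ < 1 := by simpa [unitPolydisc] using hz
    simpa [unitDisc] using (norm_le_pi_norm z k).trans_lt hz'
  have h := hF.analyticAt (Metric.isOpen_ball.mem_nhds hzk)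
  exact h.comp (f := fun z : Fin n → ℂ => z k)
    ((ContinuousLinearMap.proj (R := ℂ) (φ := fun _ : Fin n => ℂ) k).analyticAt z)

/-- The generator that belongs to `ψ = i`. It depends on the coordinate `z k` only; the vector with
all coordinates `1` is a direction in which the equation `f' = f ψ D(t ψ)` holds. -/
theorem exists_extremal_generator {n : ℕ} (k : Fin n) {Φ : ℂ → ℂ} (hΦ : IsAdmissible Φ) :
    ∃ g : (Fin n → ℂ) → ℂ, IsGenerator Φ g ∧
      deriv (fun t : ℂ => g (t • (1 : Fin n → ℂ))) =ᶠ[nhds 0]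
        fun t => g (t • (1 : Fin n → ℂ)) * (Complex.I * dslope Φ 0 (t * Complex.I)) := by
  have hnhds : unitDisc ∈ nhds (0 : ℂ) := Metric.ball_mem_nhds 0 one_pos
  have hΦd := hΦ.biholomorphic.1
  obtain ⟨L, hL0, hL⟩ :=
    ((Complex.differentiableOn_dslope hnhds).2 hΦd).isExactOn_ball.with_val_at 0 0
  have hrot : ∀ w ∈ unitDisc, w * Complex.I ∈ unitDisc := by
    intro w hw
    simpa [unitDisc] using hw
  set E : ℂ → ℂ := fun w => Complex.exp (L (w * Complex.I)) with hE
  have hE' : ∀ w ∈ unitDisc,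
      HasDerivAt E (E w * (Complex.I * dslope Φ 0 (w * Complex.I))) w := by
    intro w hw
    have h1 : HasDerivAt (fun w : ℂ => w * Complex.I) Complex.I w := by
      simpa using (hasDerivAt_id' w).mul_const Complex.I
    have h2 := ((hL _ (hrot w hw)).comp w h1).cexp
    simpa [hE, Function.comp_def, mul_comm] using h2
  have hEd : DifferentiableOn ℂ E unitDisc := fun w hw =>
    (hE' w hw).differentiableAt.differentiableWithinAt
  have hHd : DifferentiableOn ℂ (fun w => (Φ (w * Complex.I))⁻¹) unitDisc := by
    refine DifferentiableOn.inv (hΦd.comp (by fun_prop) hrot) fun w hw h => ?_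
    have := hΦ.re_pos _ (hrot w hw)
    simp [h] at this
  have hmem : ∀ z ∈ unitPolydisc n, z k ∈ unitDisc := by
    intro z hz
    have hz' : ‖z‖ < 1 := by simpa [unitPolydisc] using hz
    simpa [unitDisc] using (norm_le_pi_norm z k).trans_lt hz'
  have hga := analyticOnNhd_comp_apply hEd k
  have hHa := analyticOnNhd_comp_apply hHd k
  have hsum : ∀ z ∈ unitPolydisc n, E (z k) + fderiv ℂ (fun z : Fin n → ℂ => E (z k)) z z =
      E (z k) * Φ (z k * Complex.I) := by
    intro z hz
    have h1 : HasFDerivAt (fun z : Fin n → ℂ => E (z k)) _ z :=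
      HasDerivAt.comp_hasFDerivAt (h₂ := E) (f := fun z : Fin n → ℂ => z k) z (hE' _ (hmem z hz))
        (ContinuousLinearMap.proj (R := ℂ) (φ := fun _ : Fin n => ℂ) k).hasFDerivAt
    have h2 := sub_smul_dslope Φ 0 (z k * Complex.I)
    rw [hΦ.map_zero, sub_zero, smul_eq_mul] at h2
    rw [h1.fderiv]
    simp only [smul_apply, ContinuousLinearMap.proj_apply, smul_eq_mul]
    linear_combination E (z k) * h2
  have hΦ0 : ∀ z ∈ unitPolydisc n, Φ (z k * Complex.I) ≠ 0 := by
    intro z hz h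
    have := hΦ.re_pos _ (hrot _ (hmem z hz))
    simp [h] at this
  have hinv : ∀ z ∈ unitPolydisc n,
      (fderiv ℂ (scaledId fun z : Fin n → ℂ => E (z k)) z).IsInvertible := by
    intro z hz
    refine isInvertible_fderiv_scaledId (hga z hz).differentiableAt (Complex.exp_ne_zero _) ?_
    rw [hsum z hz]
    exact mul_ne_zero (Complex.exp_ne_zero _) (hΦ0 z hz)
  -- Here `(DG)⁻¹ G` is `z / Φ(i z_k)`, so that `z_j / p_j` is `Φ(i z_k)` for every `j`.
  set p : (Fin n → ℂ) → (Fin n → ℂ) := scaledId fun z => (Φ (z k * Complex.I))⁻¹ with hp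
  have hpeq : Set.EqOn p (fun z => (fderiv ℂ (scaledId fun z : Fin n → ℂ => E (z k)) z).inverse
      (scaledId (fun z : Fin n → ℂ => E (z k)) z)) (unitPolydisc n) := by
    intro z hz
    have h1 := smul_inverse_fderiv_scaledId (hga z hz).differentiableAt (hinv z hz)
    rw [hsum z hz, mul_smul] at h1
    have h2 := smul_right_injective _ (Complex.exp_ne_zero _) h1
    have h3 := congrArg ((Φ (z k * Complex.I))⁻¹ • ·) h2
    simp only [smul_smul, inv_mul_cancel₀ (hΦ0 z hz), one_smul] at h3
    exact h3.symm
  have h0 : (0 : Fin n → ℂ) ∈ unitPolydisc n := Metric.mem_ball_self one_pos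
  refine ⟨fun z => E (z k), ⟨hga, by simp [hE, hL0], hinv, ?_, ?_, ?_, ?_⟩, ?_⟩
  · exact AnalyticOnNhd.congr Metric.isOpen_ball (hHa.smul analyticOnNhd_id) hpeq
  · simp [scaledId]
  · rw [← (hpeq.eventuallyEq_of_mem (Metric.isOpen_ball.mem_nhds h0)).fderiv_eq]
    ext1 v
    rw [hp, fderiv_scaledId (hHa 0 h0).differentiableAt]
    simp [hΦ.map_zero]
  · intro z hz hz0 j hj
    have hzj : z j ≠ 0 := by
      rw [← norm_ne_zero_iff, hj, norm_ne_zero_iff]; exact hz0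
    rw [← hpeq hz]
    refine ⟨mul_ne_zero (inv_ne_zero (hΦ0 z hz)) hzj, z k * Complex.I, hrot _ (hmem z hz), ?_⟩
    have := hΦ0 z hz
    simp only [hp, scaledId, Pi.smul_apply, smul_eq_mul]
    field_simp
  · filter_upwards [hnhds] with t ht
    simpa using (hE' t ht).deriv

theorem theorem5 (n : ℕ) (hn : 0 < n) (Φ : ℂ → ℂ) (hΦ : IsAdmissible Φ)
    (hcond : 2 * (deriv Φ 0).re ≤
      |(iteratedDeriv 2 Φ 0).re + 2 * (deriv Φ 0).re ^ 2|) :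
    (∀ g : (Fin n → ℂ) → ℂ, IsGenerator Φ g → ∀ z ∈ unitPolydisc n,
      ‖homTerm 3 (scaledId g) z ^ 2 - homTerm 2 (scaledId g) z ^ 2‖ ≤
        toeplitzBound (deriv Φ 0).re (iteratedDeriv 2 Φ 0).re ‖z‖) ∧
    (∃ g : (Fin n → ℂ) → ℂ, IsGenerator Φ g ∧
      ∀ r ∈ Set.Ioo (0 : ℝ) 1, ∃ z ∈ unitPolydisc n, ‖z‖ = r ∧
        ‖homTerm 3 (scaledId g) z ^ 2 - homTerm 2 (scaledId g) z ^ 2‖ =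
          toeplitzBound (deriv Φ 0).re (iteratedDeriv 2 Φ 0).re ‖z‖) := by
  refine ⟨fun g hg z _ => hg.norm_sq_sub_sq_le hΦ hcond z, ?_⟩
  obtain ⟨g, hg, hode⟩ := exists_extremal_generator ⟨0, hn⟩ hΦ
  have hga : AnalyticAt ℂ g 0 := hg.1 0 (Metric.mem_ball_self one_pos)
  obtain ⟨h1, h2⟩ := coeff_of_schwarz_function hΦ hga hg.2.1 1 (ψ := fun _ => Complex.I)
    (differentiableOn_const _) hode
  have : Nonempty (Fin n) := ⟨⟨0, hn⟩⟩
  refine ⟨g, hg, fun r hr => ?_⟩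
  have hnorm : ‖(r : ℂ) • (1 : Fin n → ℂ)‖ = r := by
    rw [norm_smul, norm_one, mul_one, Complex.norm_real, Real.norm_of_nonneg hr.1.le]
  refine ⟨(r : ℂ) • 1, ?_, hnorm, ?_⟩
  · rw [unitPolydisc, mem_ball_zero_iff, hnorm]
    exact hr.2
  rw [homTerm_sq_sub_sq hga, h1, h2, hnorm, toeplitzBound_eq hΦ.deriv_pos.ne', one_pow, norm_smul,
    norm_one, mul_one]
  generalize (deriv Φ 0).re = a
  generalize (iteratedDeriv 2 Φ 0).re = b
  have h3 : ((r : ℂ) ^ 3 * ((((a ^ 2 + b / 2 : ℝ) : ℂ) * Complex.I ^ 2 +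
        a * deriv (fun _ : ℂ => Complex.I) 0) / 2)) ^ 2 - ((r : ℂ) ^ 2 * (a * Complex.I)) ^ 2 =
      (((r ^ 3 * ((a ^ 2 + b / 2) / 2)) ^ 2 + (r ^ 2 * a) ^ 2 : ℝ) : ℂ) := by
    rw [deriv_const, Complex.I_sq]
    push_cast
    linear_combination (-((r : ℂ) ^ 4 * a ^ 2)) * Complex.I_sq
  rw [h3, Complex.norm_real, Real.norm_of_nonneg (by positivity)]
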